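/- Complex numbers $z_1,\dots,z_n$ are called multiplicatively dependent if they are all non-zero and there is a non-zero integer vector $(k_1,\dots,k_n)\in\mathbb{Z}^n$ with $z_1^{k_1}\cdots z_n^{k_n}=1$. Given pairwise distinct algebraic numbers $\alpha_1,\dots,\alpha_n\in\mathbb{C}$, there are only finitely many integers $t\in\mathbb{Z}$ for which the numbers $\alpha_1+t,\dots,\alpha_n+t$ are multiplicatively dependent. In particular, for every integer $d\neq 0$, the set $\mathcal{M}(d)$ of all pairs $(a,b)\in\mathbb{Z}^2$ such that $b-a=d$ and $a,b$ are multiplicatively dependent is finite. -/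

import Mathlib

/-- A complex vector `z` is multiplicatively dependent if all its coordinates are non-zero and
some non-zero integer vector `k` satisfies `∏ i, z i ^ k i = 1`. -/
def MultiplicativelyDependent {n : ℕ} (z : Fin n → ℂ) : Prop :=
  (∀ i, z i ≠ 0) ∧ ∃ k : Fin n → ℤ, k ≠ 0 ∧ ∏ i, z i ^ k i = 1

/-- The set `M(d)` of multiplicatively dependent integer vectors `(a, b)`
with difference `b - a = d`. -/
def multDependentPairs (d : ℤ) : Set (ℤ × ℤ) :=
  {p | MultiplicativelyDependent ![(p.1 : ℂ), (p.2 : ℂ)] ∧ p.2 - p.1 = d}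

/-!
Let `m ≠ 0` be an integer such that every `m * α i` is an algebraic integer, and suppose that
`∏ j, (α j + t) ^ k j = 1` with `|k i| > 0` maximal. Raised to the power `|k i|`, the quotient of
`∏ j ≠ i, m ^ 2 * (α j + t)` by `α i + t` becomes an algebraic integer, because the exponents `k j`
are dominated by `|k i|` and the factors `m` absorb all denominators. The ring of algebraic integers
is integrally closed, so the quotient itself is an algebraic integer
(`exists_isIntegral_prod_div_of_dependent`). As `α j + t` is congruent to `α j - α i` modulo
`α i + t`, it follows that `δ / (α i + t)` is an algebraic integer, where
`δ = ∏ j ≠ i, m ^ 2 * (α j - α i)` is nonzero and does not depend on `t`. Taking norms to `ℚ`, the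
norm of `α i + t`, which is a nonconstant polynomial in `t`, is bounded by the norm of `δ`. Hence
there are only finitely many such `t` (`finite_setOf_isIntegral_div_add`).
-/

/-- If `m` and `m * z` are algebraic integers, then `(m ^ 2 * z) ^ k * z ^ l` is one as soon as
`|l| ≤ k`: one factor `m ^ k` clears the denominator of `z ^ l` for `l ≥ 0`, while `z ^ k` cancels
`z ^ l` for `l < 0`. -/
lemma isIntegral_pow_mul_zpow {m z : ℂ} (hm : IsIntegral ℤ m) (hmz : IsIntegral ℤ (m * z))
    (hz : z ≠ 0) {k : ℕ} {l : ℤ} (hl : l.natAbs ≤ k) :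
    IsIntegral ℤ ((m ^ 2 * z) ^ k * z ^ l) := by
  obtain ⟨r, rfl⟩ := Nat.exists_eq_add_of_le hl
  rcases Int.natAbs_eq l with h | h
  · have e : (m ^ 2 * z) ^ (l.natAbs + r) * z ^ l
        = m ^ r * (m * z) ^ (l.natAbs + r) * (m * z) ^ l.natAbs := by
      conv_lhs => rw [h]
      rw [zpow_natCast]
      simp only [Int.natAbs_natCast]
      ring
    rw [e]
    exact ((hm.pow _).mul (hmz.pow _)).mul (hmz.pow _)
  · have e : (m ^ 2 * z) ^ (l.natAbs + r) * z ^ l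
        = m ^ (2 * l.natAbs + r) * (m * z) ^ r := by
      conv_lhs => rw [h]
      rw [zpow_neg, zpow_natCast]
      simp only [Int.natAbs_natCast, Int.natAbs_neg]
      field_simp
      ring
    rw [e]
    exact (hm.pow _).mul (hmz.pow _)

lemma exists_isIntegral_prod_div_of_dependent {n : ℕ} {z : Fin n → ℂ}
    (hz : MultiplicativelyDependent z) {m : ℂ} (hm : IsIntegral ℤ m)
    (hmz : ∀ i, IsIntegral ℤ (m * z i)) :
    ∃ i, IsIntegral ℤ ((∏ j ∈ Finset.univ.erase i, m ^ 2 * z j) / z i) := by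
  obtain ⟨hz0, k, hk, hprod⟩ := hz
  obtain ⟨i₀, hi₀⟩ := Function.ne_iff.mp hk
  obtain ⟨i, -, hi⟩ := Finset.exists_max_image Finset.univ (fun i => (k i).natAbs) ⟨i₀, by simp⟩
  have hpos : 0 < (k i).natAbs := (Int.natAbs_pos.mpr hi₀).trans_le (hi i₀ (Finset.mem_univ _))
  -- Replacing `k` by `-k` if necessary, the dominant exponent is positive.
  obtain ⟨l, hl, hlk, hlprod⟩ : ∃ l : Fin n → ℤ, l i = (k i).natAbs ∧
      (∀ j, (l j).natAbs = (k j).natAbs) ∧ ∏ j, z j ^ l j = 1 := by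
    rcases Int.natAbs_eq (k i) with h | h
    · exact ⟨k, h, fun _ => rfl, hprod⟩
    · exact ⟨-k, by simp only [Pi.neg_apply]; omega, fun j => by simp,
        by simp [zpow_neg, Finset.prod_inv_distrib, hprod]⟩
  refine ⟨i, IsIntegral.of_pow hpos ?_⟩
  have hrest : ∏ j ∈ Finset.univ.erase i, z j ^ l j = (z i ^ (k i).natAbs)⁻¹ := by
    rw [← Finset.mul_prod_erase _ _ (Finset.mem_univ i), hl, zpow_natCast] at hlprod
    exact eq_inv_of_mul_eq_one_right hlprod
  have e : ((∏ j ∈ Finset.univ.erase i, m ^ 2 * z j) / z i) ^ (k i).natAbs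
      = ∏ j ∈ Finset.univ.erase i, (m ^ 2 * z j) ^ (k i).natAbs * z j ^ l j := by
    rw [Finset.prod_mul_distrib (f := fun j => (m ^ 2 * z j) ^ (k i).natAbs), hrest, div_pow,
      Finset.prod_pow, div_eq_mul_inv]
  rw [e]
  exact IsIntegral.prod _ fun j _ => isIntegral_pow_mul_zpow hm (hmz j) (hz0 j)
    ((hlk j).trans_le (hi j (Finset.mem_univ _)))

/-- Modulo `z`, the product of the `a j + b * z` is congruent to the product of the `a j`. -/
lemma isIntegral_prod_add_sub_prod_div {ι : Type*} (s : Finset ι) {a : ι → ℂ} {b z : ℂ}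
    (hz : z ≠ 0) (ha : ∀ j, IsIntegral ℤ (a j)) (hb : IsIntegral ℤ b)
    (hbz : IsIntegral ℤ (b * z)) :
    IsIntegral ℤ ((∏ j ∈ s, (a j + b * z) - ∏ j ∈ s, a j) / z) := by
  classical
  induction s using Finset.induction_on with
  | empty => simpa using isIntegral_zero
  | insert i s hi ih =>
    rw [Finset.prod_insert hi, Finset.prod_insert hi]
    have e : ((a i + b * z) * ∏ j ∈ s, (a j + b * z) - a i * ∏ j ∈ s, a j) / z
        = a i * ((∏ j ∈ s, (a j + b * z) - ∏ j ∈ s, a j) / z)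
          + b * ∏ j ∈ s, (a j + b * z) := by
      field_simp
      ring
    rw [e]
    exact ((ha i).mul ih).add (hb.mul (IsIntegral.prod _ fun j _ => (ha j).add hbz))

/-- The norm of `β + t` is the value at `t` of the characteristic polynomial of `-β`. -/
lemma norm_add_intCast {K : Type*} [Field K] [NumberField K] (β : K) (t : ℤ) :
    Algebra.norm ℚ (β + t) = (Algebra.lmul ℚ K (-β)).charpoly.eval (t : ℚ) := by
  rw [LinearMap.eval_charpoly, Algebra.norm_apply]
  congr 1
  ext x
  simp
  ring

lemma finite_setOf_isIntegral_div_add_of_numberField {K : Type*} [Field K] [NumberField K]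
    (β : K) {δ : K} (hδ : δ ≠ 0) :
    {t : ℤ | β + t ≠ 0 ∧ IsIntegral ℤ (δ / (β + t))}.Finite := by
  set P := (Algebra.lmul ℚ K (-β)).charpoly
  have hP : 0 < P.degree := by
    rw [Polynomial.degree_eq_natDegree (LinearMap.charpoly_monic _).ne_zero,
      LinearMap.charpoly_natDegree]
    exact_mod_cast Module.finrank_pos
  have hcast : Filter.Tendsto (fun t : ℤ => ‖(t : ℚ)‖) Filter.cofinite Filter.atTop := by
    rw [← Filter.cocompact_eq_cofinite ℤ]
    simpa using tendsto_norm_cocompact_atTop (E := ℤ)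
  have hlim := Polynomial.tendsto_norm_atTop P hP hcast
  have hfin := hlim.eventually (Filter.eventually_gt_atTop ‖Algebra.norm ℚ δ‖)
  rw [Filter.eventually_cofinite] at hfin
  refine hfin.subset ?_
  rintro t ⟨ht, hint⟩
  obtain ⟨c, hc⟩ := IsIntegrallyClosed.isIntegral_iff.mp (Algebra.isIntegral_norm ℚ hint)
  have hmul : Algebra.norm ℚ δ = (c : ℚ) * P.eval (t : ℚ) := by
    rw [← norm_add_intCast, show (c : ℚ) = Algebra.norm ℚ (δ / (β + t)) from hc, ← map_mul,
      div_mul_cancel₀ _ ht]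
  have hc0 : c ≠ 0 := by
    rintro rfl
    exact Algebra.norm_ne_zero_iff.mpr hδ (by rw [hmul, Int.cast_zero, zero_mul])
  have hc1 : (1 : ℝ) ≤ ‖(c : ℚ)‖ := by
    rw [Int.norm_cast_rat, Int.norm_eq_abs]
    exact_mod_cast Int.one_le_abs hc0
  simp only [Set.mem_ofPred_eq, not_lt, hmul, norm_mul]
  exact le_mul_of_one_le_left (norm_nonneg _) hc1

lemma finite_setOf_isIntegral_div_add {β δ : ℂ} (hβ : IsAlgebraic ℚ β) (hδ : IsAlgebraic ℚ δ)
    (hδ0 : δ ≠ 0) : {t : ℤ | β + t ≠ 0 ∧ IsIntegral ℤ (δ / (β + t))}.Finite := by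
  let K := IntermediateField.adjoin ℚ ({β, δ} : Set ℂ)
  have : FiniteDimensional ℚ K :=
    IntermediateField.finiteDimensional_adjoin fun x hx => by
      rcases hx with rfl | rfl
      exacts [hβ.isIntegral, hδ.isIntegral]
  have : NumberField K := ⟨⟩
  let β' : K := ⟨β, IntermediateField.subset_adjoin _ _ (by simp)⟩
  let δ' : K := ⟨δ, IntermediateField.subset_adjoin _ _ (by simp)⟩
  refine (finite_setOf_isIntegral_div_add_of_numberField β' (δ := δ')
    fun h => hδ0 (congrArg Subtype.val h)).subset ?_
  rintro t ⟨ht, hint⟩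
  refine ⟨fun h => ht (by simpa [β'] using congrArg (algebraMap K ℂ) h), ?_⟩
  rw [← isIntegral_algebraMap_iff (algebraMap K ℂ).injective]
  simpa [β', δ'] using hint

theorem finite_setOf_multiplicativelyDependent_add {n : ℕ} {α : Fin n → ℂ}
    (hα : ∀ i, IsAlgebraic ℚ (α i)) (hinj : Function.Injective α) :
    {t : ℤ | MultiplicativelyDependent (fun i => α i + (t : ℂ))}.Finite := by
  choose r hr0 hr using fun i =>
    ((IsFractionRing.isAlgebraic_iff ℤ ℚ ℂ).mpr (hα i)).exists_integral_multiple
  obtain ⟨m, hm0, hm⟩ : ∃ m : ℤ, m ≠ 0 ∧ ∀ i, IsIntegral ℤ ((m : ℂ) * α i) := by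
    refine ⟨∏ i, r i, Finset.prod_ne_zero_iff.mpr fun i _ => hr0 i, fun i => ?_⟩
    rw [← zsmul_eq_mul, ← Finset.prod_erase_mul _ _ (Finset.mem_univ i), mul_smul]
    exact (hr i).smul _
  have hint (s : ℤ) : IsIntegral ℤ (s : ℂ) := isIntegral_algebraMap (x := s)
  let δ (i : Fin n) : ℂ := ∏ j ∈ Finset.univ.erase i, (m : ℂ) ^ 2 * (α j - α i)
  have hδ (i : Fin n) (j : Fin n) : IsIntegral ℤ ((m : ℂ) ^ 2 * (α j - α i)) := by
    have e : (m : ℂ) ^ 2 * (α j - α i) = m * (m * α j - m * α i) := by ring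
    rw [e]
    exact (hint m).mul ((hm j).sub (hm i))
  have hδ0 (i : Fin n) : δ i ≠ 0 := by
    refine Finset.prod_ne_zero_iff.mpr fun j hj => mul_ne_zero (by simpa using hm0) ?_
    exact sub_ne_zero.mpr (hinj.ne (Finset.ne_of_mem_erase hj))
  have hδalg (i : Fin n) : IsAlgebraic ℚ (δ i) :=
    (IsIntegral.prod _ fun j _ => hδ i j).tower_top.isAlgebraic
  refine (Set.finite_iUnion fun i =>
    finite_setOf_isIntegral_div_add (hα i) (hδalg i) (hδ0 i)).subset ?_
  intro t ht
  have hmt (i : Fin n) : IsIntegral ℤ ((m : ℂ) * (α i + t)) := by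
    rw [mul_add]
    exact (hm i).add ((hint m).mul (hint t))
  obtain ⟨i, hi⟩ := exists_isIntegral_prod_div_of_dependent ht (hint m) hmt
  have hne : α i + t ≠ 0 := ht.1 i
  refine Set.mem_iUnion.mpr ⟨i, hne, ?_⟩
  have hdiff := isIntegral_prod_add_sub_prod_div (Finset.univ.erase i) hne (hδ i)
    ((hint m).pow 2) (by rw [pow_two, mul_assoc]; exact (hint m).mul (hmt i))
  have e : δ i / (α i + t) = (∏ j ∈ Finset.univ.erase i, (m : ℂ) ^ 2 * (α j + t)) / (α i + t)
      - (∏ j ∈ Finset.univ.erase i, ((m : ℂ) ^ 2 * (α j - α i) + (m : ℂ) ^ 2 * (α i + t))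
        - ∏ j ∈ Finset.univ.erase i, (m : ℂ) ^ 2 * (α j - α i)) / (α i + t) := by
    rw [← sub_div]
    congr 1
    rw [eq_sub_iff_add_eq, add_sub_cancel]
    exact Finset.prod_congr rfl fun j _ => by ring
  rw [e]
  exact hi.sub hdiff

theorem mainTheorem3 :
    (∀ (n : ℕ) (α : Fin n → ℂ), (∀ i, IsAlgebraic ℚ (α i)) → Function.Injective α →
      {t : ℤ | MultiplicativelyDependent (fun i => α i + (t : ℂ))}.Finite) ∧
    (∀ d : ℤ, d ≠ 0 → (multDependentPairs d).Finite) := by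
  refine ⟨fun n α hα hinj => finite_setOf_multiplicativelyDependent_add hα hinj, fun d hd => ?_⟩
  -- A pair `(a, b)` with `b - a = d` is the translation of `(0, d)` by `a`.
  have hfin := finite_setOf_multiplicativelyDependent_add (α := ![0, (d : ℂ)])
    (by
      intro i
      fin_cases i
      · exact isAlgebraic_zero
      · exact isAlgebraic_intCast d)
    (by
      intro i j h
      fin_cases i <;> fin_cases j <;> simp_all [eq_comm])
  refine (hfin.image fun t => (t, t + d)).subset ?_
  rintro ⟨a, b⟩ ⟨hdep, hab⟩
  obtain rfl : b = a + d := by simp only at hab; omega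
  refine ⟨a, ?_, rfl⟩
  have e : (fun i => ![0, (d : ℂ)] i + (a : ℂ)) = ![(a : ℂ), ((a + d : ℤ) : ℂ)] := by
    ext i
    fin_cases i <;> simp [add_comm]
  simpa only [Set.mem_ofPred_eq, e] using hdep
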